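/- Conventions. Let $\mu$ be an infinite regular cardinal. In a $(<\mu)$-ary language every function and relation symbol has arity $<\mu$; its size is the number of its symbols. A theory in a $(<\mu)$-ary language $L'$ is a set of sentences of $L'_{\mu,\mu}$ (conjunctions of fewer than $\mu$ formulas and quantification over fewer than $\mu$ variables; this is first-order logic if $\mu=\aleph_0$), and an $L'$-type is a set of $L'_{\mu,\mu}$-formulas in a fixed set of fewer than $\mu$ variables. $EC^\mu(T,\Gamma)$ is the class of $L'$-structures that satisfy $T$ and omit every type in $\Gamma$, and for $L\subseteq L'$, $PC^\mu(T,\Gamma,L)=\{M'\restriction L: M'\in EC^\mu(T,\Gamma)\}$. A $\mu$-AEC in a $(<\mu)$-ary language $L$ is a class $K$ of $L$-structures with a partial order $\le_K$ on $K$ such that: $M\le_K N$ implies that $M$ is a substructure of $N$; $K$ and $\le_K$ are closed under isomorphism; if $M_1\le_K M_3$, $M_2\le_K M_3$ and $M_1\subseteq M_2$, then $M_1\le_K M_2$; if $\langle M_i\in K:i\in I\rangle$ is $\mu$-directed (for every $J\subseteq I$ with $|J|<\mu$ there is $k\in I$ with $M_j\le_K M_k$ for all $j\in J$), then $M=\bigcup_i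 M_i\in K$, $M_i\le_K M$ for all $i$, and $M\le_K N$ whenever $N\in K$ and $M_i\le_K N$ for all $i$; and there is a cardinal $\lambda=\lambda^{<\mu}\ge |L|+\mu$ such that for all $M\in K$ and $A\subseteq |M|$ there is $N\le_K M$ with $A\subseteq |N|$ and $\|N\|\le |A|^{<\mu}+\lambda$. The least such $\lambda$ is $LS(K)$. Let $I_2(\lambda,K)$ be the number of isomorphism types of pairs $(M,N)$ with $M\le_K N$ and $\|M\|=\|N\|=\lambda$, where $(M_1,N_1)\cong(M_2,N_2)$ means that some isomorphism $N_1\cong N_2$ maps $M_1$ onto $M_2$. Write $K_{\ge\lambda}=\{M\in K:\|M\|\ge\lambda\}$. Theorem 5.6. Let $(K,\le_K)$ be a $\mu$-AEC in $L$, let $\lambda=LS(K)$ and $\chi=\lambda+I_2(\lambda,K)$. There are a $(<\mu)$-ary expansion $L'\supseteq L$ of size $\chi$, an $L'$-theory $T$ with $|T|\le\chi$, and a set $\Gamma$ of $L'$-types with $|\Gamma|=\chi$ such that: 1. $K_{\ge\lambda}=PC^\mu(T,\Gamma,L)$. (So $K=PC^\mu(T,\Gamma,L)$ if, as is customary, all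 members of $K$ have cardinality at least $LS(K)$.) 2. If $M',N'\in EC^\mu(T,\Gamma)$ and $M'$ is an $L'$-substructure of $N'$, then $M'\restriction L\le_K N'\restriction L$. 3. If $M\le_K N$ with $M,N\in K_{\ge\lambda}$, then there are $M',N'\in EC^\mu(T,\Gamma)$ such that $M'$ is an $L'$-substructure of $N'$, $M'\restriction L=M$ and $N'\restriction L=N$. -/

import Mathlib

open Cardinal

universe u

namespace MuAEC

/-- A `(<μ)`-ary language: a set of function symbols and a set of relation symbols (constants are
nullary function symbols). The arity of a symbol is an index set of cardinality `< μ`. -/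
structure InfLanguage (μ : Cardinal.{u}) : Type (u + 1) where
  Func : Type u
  Rel : Type u
  fArity : Func → Type u
  rArity : Rel → Type u
  fArity_lt : ∀ f, #(fArity f) < μ
  rArity_lt : ∀ R, #(rArity R) < μ

variable {μ : Cardinal.{u}}

/-- The number of symbols of the language. -/
def InfLanguage.card (L : InfLanguage μ) : Cardinal.{u} := #L.Func + #L.Rel

/-- The expansion of `L` by the symbols of `E` (disjointly added). Every language containing `L` is
of this form, with `E` the new symbols. -/
def InfLanguage.expand (L E : InfLanguage μ) : InfLanguage μ where
  Func := L.Func ⊕ E.Func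
  Rel := L.Rel ⊕ E.Rel
  fArity := Sum.elim L.fArity E.fArity
  rArity := Sum.elim L.rArity E.rArity
  fArity_lt := by
    rintro (f | f)
    · exact L.fArity_lt f
    · exact E.fArity_lt f
  rArity_lt := by
    rintro (R | R)
    · exact L.rArity_lt R
    · exact E.rArity_lt R

/-- An `L`-structure. -/
structure Struc (L : InfLanguage μ) : Type (u + 1) where
  carrier : Type u
  funMap : (f : L.Func) → (L.fArity f → carrier) → carrier
  relMap : (R : L.Rel) → (L.rArity R → carrier) → Prop

/-- A substructure of `N`, given by its universe, a subset closed under the functions of `N`. -/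
structure Substr {L : InfLanguage μ} (N : Struc L) : Type u where
  carrier : Set N.carrier
  closed : ∀ (f : L.Func) (x : L.fArity f → N.carrier),
    (∀ i, x i ∈ carrier) → N.funMap f x ∈ carrier

variable {L E : InfLanguage μ}

/-- A substructure, as an `L`-structure of its own. -/
def Substr.toStruc {N : Struc L} (A : Substr N) : Struc L where
  carrier := A.carrier
  funMap f x := ⟨N.funMap f fun i => (x i : N.carrier), A.closed f _ fun i => (x i).2⟩
  relMap R x := N.relMap R fun i => (x i : N.carrier)

/-- The whole structure as a substructure of itself. -/
def Substr.whole (N : Struc L) : Substr N where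
  carrier := Set.univ
  closed _ _ _ := Set.mem_univ _

/-- For substructures `A`, `B` of `N`: the trace of `A` on `B`, as a substructure of `B`.
It is used for `A ⊆ B` only, where it is `A` seen as a substructure of `B`. -/
def Substr.within {N : Struc L} (A B : Substr N) : Substr B.toStruc where
  carrier := {x : B.carrier | (x : N.carrier) ∈ A.carrier}
  closed f _ hx := A.closed f _ hx

/-- Isomorphisms of `L`-structures. -/
structure Iso (M N : Struc L) : Type u where
  toEquiv : M.carrier ≃ N.carrier
  map_fun : ∀ (f : L.Func) (x : L.fArity f → M.carrier),
    toEquiv (M.funMap f x) = N.funMap f fun i => toEquiv (x i)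
  map_rel : ∀ (R : L.Rel) (x : L.rArity R → M.carrier),
    M.relMap R x ↔ N.relMap R fun i => toEquiv (x i)

/-- A pair of `L`-structures, one a substructure of the other. -/
structure Pair (L : InfLanguage μ) : Type (u + 1) where
  big : Struc L
  small : Substr big

/-- `(M₁, N₁) ≅ (M₂, N₂)`: an isomorphism of `N₁` with `N₂` which maps `M₁` onto `M₂`
(and so restricts to an isomorphism of `M₁` with `M₂`). -/
def Pair.IsIso (P Q : Pair L) : Prop :=
  ∃ g : Iso P.big Q.big, ∀ x, x ∈ P.small.carrier ↔ g.toEquiv x ∈ Q.small.carrier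

/-- Data of an abstract class: a class of `L`-structures and a relation `M ≤ N`, which is
only ever considered for `M` a substructure of `N`. -/
structure AbstractClass (L : InfLanguage μ) : Type (u + 1) where
  models : Set (Struc L)
  le : Set (Pair L)

/-- The inclusion of substructures of `N`, `A ≤ B`, in the sense of the class `K`. -/
def AbstractClass.LeIn (K : AbstractClass L) {N : Struc L} (A B : Substr N) : Prop :=
  A.carrier ⊆ B.carrier ∧ (⟨B.toStruc, A.within B⟩ : Pair L) ∈ K.le

/-- A `μ`-directed system in `K`, all of whose members are substructures of `N`. (Taking `J`
empty one sees that the index set is nonempty.) -/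
structure AbstractClass.IsDirectedSystem (K : AbstractClass L) {N : Struc L} {I : Type u}
    (A : I → Substr N) : Prop where
  mem : ∀ i, (A i).toStruc ∈ K.models
  directed : ∀ J : Set I, #J < μ → ∃ k, ∀ j ∈ J, K.LeIn (A j) (A k)

/-- The Löwenheim–Skolem property of the class `K` at the cardinal `κ`. -/
def AbstractClass.HasLS (K : AbstractClass L) (κ : Cardinal.{u}) : Prop :=
  κ ^< μ = κ ∧ L.card + μ ≤ κ ∧
    ∀ M ∈ K.models, ∀ X : Set M.carrier, ∃ N : Substr M,
      X ⊆ N.carrier ∧ (⟨M, N⟩ : Pair L) ∈ K.le ∧ #N.carrier ≤ (#X) ^< μ + κ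

/-- The axioms of a `μ`-AEC. Antisymmetry of `≤`, and the axiom that `M ≤ N` implies that `M` is a
substructure of `N`, are built into the representation of `≤` by pairs. -/
structure IsMuAEC (K : AbstractClass L) : Prop where
  /-- `≤` is a relation between members of `K`. -/
  mem_of_le : ∀ P ∈ K.le, P.big ∈ K.models ∧ P.small.toStruc ∈ K.models
  le_refl : ∀ N ∈ K.models, (⟨N, Substr.whole N⟩ : Pair L) ∈ K.le
  le_trans : ∀ (N : Struc L) (A B : Substr N),
    K.LeIn A B → (⟨N, B⟩ : Pair L) ∈ K.le → (⟨N, A⟩ : Pair L) ∈ K.le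
  iso_mem : ∀ M N : Struc L, M ∈ K.models → Nonempty (Iso M N) → N ∈ K.models
  iso_le : ∀ P Q : Pair L, P ∈ K.le → P.IsIso Q → Q ∈ K.le
  coherence : ∀ (N : Struc L) (A B : Substr N), (⟨N, A⟩ : Pair L) ∈ K.le →
    (⟨N, B⟩ : Pair L) ∈ K.le → A.carrier ⊆ B.carrier → K.LeIn A B
  /-- The union `M` of a `μ`-directed system is in `K` and is above all members of the system. -/
  directed_union : ∀ (M : Struc L) (I : Type u) (A : I → Substr M), K.IsDirectedSystem A →
    (⋃ i, (A i).carrier) = Set.univ → M ∈ K.models ∧ ∀ i, (⟨M, A i⟩ : Pair L) ∈ K.le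
  /-- The union `B` of a `μ`-directed system whose members are all `≤ N` is `≤ N`. -/
  directed_le : ∀ (N : Struc L) (I : Type u) (A : I → Substr N) (B : Substr N), N ∈ K.models →
    K.IsDirectedSystem A → (∀ i, (⟨N, A i⟩ : Pair L) ∈ K.le) →
    (⋃ i, (A i).carrier) = B.carrier → (⟨N, B⟩ : Pair L) ∈ K.le
  exists_LS : ∃ κ : Cardinal.{u}, K.HasLS κ

/-- The Löwenheim–Skolem number (the infimum is a minimum in a `μ`-AEC). -/
noncomputable def AbstractClass.LS (K : AbstractClass L) : Cardinal.{u} :=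
  sInf {κ | K.HasLS κ}

/-- The pairs `M ≤ N` in `K` with both `M` and `N` of cardinality `κ`. -/
def AbstractClass.PairsOfCard (K : AbstractClass L) (κ : Cardinal.{u}) : Type (u + 1) :=
  {P : Pair L // P ∈ K.le ∧ #P.big.carrier = κ ∧ #P.small.carrier = κ}

/-- Isomorphism of pairs, as an equivalence relation. -/
def AbstractClass.pairSetoid (K : AbstractClass L) (κ : Cardinal.{u}) :
    Setoid (K.PairsOfCard κ) where
  r P Q := P.1.IsIso Q.1
  iseqv :=
    { refl := fun _ => ⟨⟨Equiv.refl _, fun _ _ => rfl, fun _ _ => Iff.rfl⟩, fun _ => Iff.rfl⟩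
      symm := by
        rintro P Q ⟨g, hg⟩
        refine ⟨⟨g.toEquiv.symm, fun f x => ?_, fun R x => ?_⟩, fun x => ?_⟩
        · rw [Equiv.symm_apply_eq, g.map_fun]; simp
        · rw [g.map_rel]; simp
        · rw [hg]; simp
      trans := by
        rintro P Q R ⟨g, hg⟩ ⟨h, hh⟩
        refine ⟨⟨g.toEquiv.trans h.toEquiv, fun f x => ?_, fun S x => ?_⟩, fun x => ?_⟩
        · simp [g.map_fun, h.map_fun]
        · rw [g.map_rel, h.map_rel]; rfl
        · rw [hg, hh]; rfl }

/-- `I₂(κ, K)`: the number of isomorphism types of pairs `M ≤ N` in `K` with `M`, `N` of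
cardinality `κ`. Structures form a large type, so this is a cardinal one universe up. -/
noncomputable def AbstractClass.I₂ (K : AbstractClass L) (κ : Cardinal.{u}) : Cardinal.{u + 1} :=
  #(Quotient (K.pairSetoid κ))

/-- Terms of the language `L` with variables from `α`. -/
inductive Term (L : InfLanguage μ) (α : Type u) : Type u
  | var (x : α) : Term L α
  | func (f : L.Func) (t : L.fArity f → Term L α) : Term L α

/-- Formulas of `L_{μ,μ}` with free variables from `α`: conjunctions of fewer than `μ` formulas,
quantification over fewer than `μ` variables (the other connectives and the existential quantifier
are abbreviations). For `μ = ℵ₀` these are the first-order formulas. -/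
inductive Formula (L : InfLanguage μ) : Type u → Type (u + 1)
  | eq {α : Type u} (s t : Term L α) : Formula L α
  | rel {α : Type u} (R : L.Rel) (t : L.rArity R → Term L α) : Formula L α
  | neg {α : Type u} (φ : Formula L α) : Formula L α
  | conj {α : Type u} (ι : Type u) (hι : #ι < μ) (φ : ι → Formula L α) : Formula L α
  | all {α : Type u} (β : Type u) (hβ : #β < μ) (φ : Formula L (α ⊕ β)) : Formula L α

/-- The value of a term. -/
def Term.value (M : Struc L) {α : Type u} (v : α → M.carrier) : Term L α → M.carrier
  | .var x => v x
  | .func f t => M.funMap f fun i => (t i).value M v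

/-- Tarski's satisfaction relation. -/
def Formula.Realize (M : Struc L) : {α : Type u} → Formula L α → (α → M.carrier) → Prop
  | _, .eq s t, v => s.value M v = t.value M v
  | _, .rel R t, v => M.relMap R fun i => (t i).value M v
  | _, .neg φ, v => ¬ φ.Realize M v
  | _, .conj _ _ φ, v => ∀ i, (φ i).Realize M v
  | _, .all β _ φ, v => ∀ w : β → M.carrier, φ.Realize M (Sum.elim v w)

/-- Sentences: formulas without free variables. -/
abbrev Sentence (L : InfLanguage μ) : Type (u + 1) := Formula L PEmpty.{u + 1}

/-- A type: a set of formulas in a fixed set of fewer than `μ` variables. -/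
structure PType (L : InfLanguage μ) : Type (u + 1) where
  vars : Type u
  vars_lt : #vars < μ
  formulas : Set (Formula L vars)

/-- `M` omits the type `p`: no tuple of `M` satisfies all formulas of `p`. -/
def Omits (M : Struc L) (p : PType L) : Prop :=
  ¬ ∃ v : p.vars → M.carrier, ∀ φ ∈ p.formulas, φ.Realize M v

/-- `EC^μ(T, Γ)`: the models of `T` that omit all types in `Γ`. -/
def EC (T : Set (Sentence L)) (Γ : Set (PType L)) : Set (Struc L) :=
  {M | (∀ φ ∈ T, φ.Realize M PEmpty.elim) ∧ ∀ p ∈ Γ, Omits M p}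

/-- The reduct to `L` of a structure for an expansion of `L`. -/
def Struc.reduct (M : Struc (L.expand E)) : Struc L where
  carrier := M.carrier
  funMap f x := M.funMap (Sum.inl f) x
  relMap R x := M.relMap (Sum.inl R) x

/-- `PC^μ(T, Γ, L)`: the reducts to `L` of the members of `EC^μ(T, Γ)`. -/
def PC (T : Set (Sentence (L.expand E))) (Γ : Set (PType (L.expand E))) : Set (Struc L) :=
  Struc.reduct '' EC T Γ

/-- The reduct to `L` of a pair of structures for an expansion of `L`. -/
def Pair.reduct (P : Pair (L.expand E)) : Pair L where
  big := P.big.reduct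
  small := ⟨P.small.carrier, fun f x hx => P.small.closed (Sum.inl f) x hx⟩

end MuAEC

open MuAEC

/-!
The presentation attaches to every tuple `a` of length `< μ` of a structure `M` a submodel `M_a` of
cardinality `λ = LS(K)`, listed by `λ` function symbols. Besides, for every reindexing `s` which
turns `a` into a shorter tuple `a ∘ s`, relation symbols name the isomorphism type of the pair
`(M_{a ∘ s}, M_a)`, one symbol for each of the `I₂(λ, K)` isomorphism types of pairs `M ≤ N` in `K`.
There are only `λ` reindexings as `λ^{<μ} = λ`, so the language has `χ = λ + I₂(λ, K)` symbols.

To express that `(M_{a ∘ s}, M_a)` is isomorphic to a given pair, the isomorphism has to be named.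
It depends on `s`, so the language has, for every `s`, a second listing of `M_a`, along which the
larger member of the given pair is to be embedded. That this is an embedding is expressed by
`λ` sentences for each relation symbol; that the two listings of `M_a` have the same range, that the
smaller member goes onto `M_{a ∘ s}`, that `a` lies in `M_a`, and that the pair has some isomorphism
type, is expressed by omitting types. All this makes up the notion `IsPresentation`, which is
universal, so that it passes to substructures.

In a presentation `M`, fewer than `μ` tuples are always reindexings of one longer tuple, because
`μ` is regular (`exists_common_extension`). So the `M_a`, for `a` in a substructure `S`, are a
`μ`-directed system with union `S`. The union axioms give first `M ∈ K` and `M_a ≤ M`, and then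
`S ≤ M` (`IsPresentation.reduct_le`).

Conversely, let `S ≤ N` be in `K`. Submodels `M_a ≤ N` with `a ∈ M_a`, with `M_{a ∘ s} ⊆ M_a`, and
with `M_a ⊆ S` if `a` is in `S`, are chosen by recursion on the length of `a` (`tower`); coherence
gives `M_{a ∘ s} ≤ M_a`. Requiring `a ∘ s` to be shorter than `a` makes the recursion well-founded
for uncountable `μ`, too, and does not affect directedness. The symbols are then interpreted
accordingly (`AbstractClass.HasLS.exists_isPresentation`).
-/

namespace MuAEC

/-! ### Cardinal arithmetic and index sets -/

theorem mk_sigma_le_of_le {ι : Type u} {f : ι → Type u} {κ κ' : Cardinal.{u}}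
    (hι : #ι ≤ κ) (hf : ∀ i, #(f i) ≤ κ') : #(Σ i, f i) ≤ κ * κ' := by
  rw [mk_sigma]
  calc (Cardinal.sum fun i => #(f i)) ≤ Cardinal.sum fun _ : ι => κ' := sum_le_sum _ _ hf
    _ = #ι * κ' := by simp
    _ ≤ κ * κ' := by gcongr

theorem mk_fun_le_of_powerlt {μ κ : Cardinal.{u}} (hκ : κ ^< μ = κ) {α β : Type u}
    (hα : #α < μ) (hβ : #β ≤ κ) : #(α → β) ≤ κ := by
  calc #(α → β) = #β ^ #α := by simp
    _ ≤ κ ^ #α := power_le_power_right hβ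
    _ ≤ κ ^< μ := le_powerlt κ hα
    _ = κ := hκ

/-- The index set for the lengths of tuples: a well-order of type `μ`. The tuples of length `i` are
the functions on the initial segment `Set.Iio i`. -/
abbrev Idx (μ : Cardinal.{u}) : Type u := μ.ord.ToType

theorem mk_Iio_idx_lt {μ : Cardinal.{u}} (i : Idx μ) : #(Set.Iio i) < μ :=
  (mk_Iio_lt i (by simp)).trans_eq (mk_ord_toType μ)

/-- Below `μ` there is room for fewer than `μ` given lengths and for the coding of a set of
cardinality `< μ`. Regularity of `μ` makes the given lengths bounded. -/
theorem exists_index {μ : Cardinal.{u}} (hμ : μ.IsRegular) {T : Set (Idx μ)} (hT : #T < μ)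
    {α : Type u} (hα : #α < μ) :
    ∃ k : Idx μ, (∀ j ∈ T, j < k) ∧ Nonempty (α ↪ Set.Iio k) := by
  obtain ⟨l, hl⟩ : ∃ l : Idx μ, #(Set.Iio l) = #α := by
    obtain ⟨l, hl⟩ := Ordinal.typein_surj (α := Idx μ) (· < ·) (o := (#α).ord)
      (by rw [Ordinal.type_toType]; exact ord_lt_ord.2 hα)
    refine ⟨l, ?_⟩
    have := Ordinal.card_typein (α := Idx μ) (r := (· < ·)) l
    rw [hl, card_ord] at this
    exact this.symm
  have hT' : ¬ IsCofinal (insert l T) := by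
    intro h
    have h1 := Order.cof_le h
    rw [Ordinal.cof_toType, hμ.cof_ord] at h1
    have h2 : #(insert l T : Set (Idx μ)) < μ :=
      mk_insert_le.trans_lt (add_lt_of_lt hμ.aleph0_le hT (hμ.nat_lt 1 |>.trans_eq' (by simp)))
    exact absurd h1 (not_le.2 h2)
  simp only [IsCofinal, not_forall, not_exists, not_and, not_le] at hT'
  obtain ⟨k, hk⟩ := hT'
  refine ⟨k, fun j hj => hk j (Set.mem_insert_of_mem _ hj), ?_⟩
  have hlk : l < k := hk l (Set.mem_insert _ _)
  have : #α ≤ #(Set.Iio k) := hl ▸ mk_le_mk_of_subset (Set.Iio_subset_Iio hlk.le)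
  exact this

/-- A reindexing, which turns a tuple of length `tgt` into one of smaller length `src`. -/
structure Reindexing (μ : Cardinal.{u}) : Type u where
  src : Idx μ
  tgt : Idx μ
  lt : src < tgt
  map : Set.Iio src → Set.Iio tgt

theorem mk_reindexing_le {μ κ : Cardinal.{u}} (hμ : ℵ₀ ≤ μ) (hκ : κ ^< μ = κ) (hμκ : μ ≤ κ) :
    #(Reindexing μ) ≤ κ := by
  have h0 := hμ.trans hμκ
  have h1 : #(Reindexing μ) ≤ #(Σ j : Idx μ, Σ i : Idx μ, (Set.Iio j → Set.Iio i)) := by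
    refine mk_le_of_injective (f := fun s => ⟨s.src, s.tgt, s.map⟩) ?_
    rintro ⟨_, _, _, _⟩ ⟨_, _, _, _⟩ h
    cases h
    rfl
  have hI : #(Idx μ) ≤ κ := by simpa using hμκ
  refine h1.trans ?_
  rw [← mul_eq_self h0]
  refine mk_sigma_le_of_le hI fun j => ?_
  rw [← mul_eq_self h0]
  exact mk_sigma_le_of_le hI fun i =>
    mk_fun_le_of_powerlt hκ (mk_Iio_idx_lt j) ((mk_Iio_idx_lt i).le.trans hμκ)

/-! ### Substructures and isomorphisms -/

variable {μ : Cardinal.{u}} {L : InfLanguage μ}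

@[ext]
theorem Substr.ext {N : Struc L} {A B : Substr N} (h : A.carrier = B.carrier) : A = B := by
  cases A; cases B; cases h; rfl

/-- Embeddings of `L`-structures. -/
structure IsEmb (M N : Struc L) (h : M.carrier → N.carrier) : Prop where
  inj : Function.Injective h
  map_fun : ∀ (f : L.Func) (x : L.fArity f → M.carrier),
    N.funMap f (fun i => h (x i)) = h (M.funMap f x)
  map_rel : ∀ (R : L.Rel) (x : L.rArity R → M.carrier),
    N.relMap R (fun i => h (x i)) ↔ M.relMap R x

/-- The image of a substructure under an embedding. -/
def IsEmb.image {M N : Struc L} {h : M.carrier → N.carrier} (hh : IsEmb M N h) (A : Substr M) :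
    Substr N where
  carrier := h '' A.carrier
  closed f x hx := by
    choose y hy hyx using hx
    obtain rfl : (fun i => h (y i)) = x := funext hyx
    exact ⟨_, A.closed f y hy, (hh.map_fun f y).symm⟩

theorem Substr.isEmb_coe {N : Struc L} (A : Substr N) :
    IsEmb A.toStruc N (fun x : A.carrier => (x : N.carrier)) where
  inj := Subtype.val_injective
  map_fun _ _ := rfl
  map_rel _ _ := Iff.rfl

/-- If `h` embeds the larger member of `P` into `N` with image `B`, and maps the smaller one onto
`A`, then `P` is isomorphic to the pair `(A, B)`. -/
theorem IsEmb.pair_isIso {P : Pair L} {N : Struc L} {h : P.big.carrier → N.carrier}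
    (hh : IsEmb P.big N h) {A B : Substr N} (hB : Set.range h = B.carrier)
    (hA : h '' P.small.carrier = A.carrier) : P.IsIso ⟨B.toStruc, A.within B⟩ := by
  have hmem : ∀ x, h x ∈ B.carrier := fun x => hB ▸ Set.mem_range_self x
  let g : P.big.carrier → B.carrier := fun x => ⟨h x, hmem x⟩
  have hg : Function.Bijective g := by
    refine ⟨fun x y hxy => hh.inj (congrArg Subtype.val hxy), fun ⟨y, hy⟩ => ?_⟩
    obtain ⟨x, rfl⟩ := hB ▸ hy
    exact ⟨x, rfl⟩
  refine ⟨⟨Equiv.ofBijective g hg, fun f x => ?_, fun R x => ?_⟩, fun x => ?_⟩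
  · exact Subtype.ext (hh.map_fun f x).symm
  · exact (hh.map_rel R x).symm
  · change _ ↔ h x ∈ A.carrier
    rw [← hA]
    exact ⟨fun hx => ⟨x, hx, rfl⟩, fun ⟨y, hy, hyx⟩ => hh.inj hyx ▸ hy⟩

/-- An isomorphism of `P` with the pair `(A, B)` of substructures of `N` is an embedding into `N`
of the larger member of `P`. -/
theorem Pair.IsIso.exists_isEmb {P : Pair L} {N : Struc L} {A B : Substr N}
    (h : P.IsIso ⟨B.toStruc, A.within B⟩) (hAB : A.carrier ⊆ B.carrier) :
    ∃ g : P.big.carrier → N.carrier, IsEmb P.big N g ∧ Set.range g = B.carrier ∧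
      g '' P.small.carrier = A.carrier := by
  obtain ⟨i, hi⟩ := h
  refine ⟨fun x => @Subtype.val N.carrier (· ∈ B.carrier) (i.toEquiv x),
    ⟨?_, fun f x => ?_, fun R x => ?_⟩, ?_, ?_⟩
  · exact fun x y hxy => i.toEquiv.injective (Subtype.ext hxy)
  · exact (congrArg Subtype.val (i.map_fun f x)).symm
  · exact (i.map_rel R x).symm
  · ext y
    refine ⟨?_, fun hy => ⟨i.toEquiv.symm ⟨y, hy⟩, ?_⟩⟩
    · rintro ⟨x, rfl⟩
      exact Subtype.prop (p := (· ∈ B.carrier)) (i.toEquiv x)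
    · exact congrArg Subtype.val (i.toEquiv.apply_symm_apply ⟨y, hy⟩)
  · ext y
    constructor
    · rintro ⟨x, hx, rfl⟩
      exact (hi x).1 hx
    · intro hy
      have h1 := i.toEquiv.apply_symm_apply ⟨y, hAB hy⟩
      refine ⟨i.toEquiv.symm ⟨y, hAB hy⟩, (hi _).2 ?_, congrArg Subtype.val h1⟩
      exact Set.mem_of_eq_of_mem h1 (show _ ∈ (A.within B).carrier from hy)

/-! ### Strong substructures -/

section Strong

variable {K : AbstractClass L} {N : Struc L} {A B : Substr N}

/-- Membership of `A` in the class is known for `A` as a substructure of `B`, and passes to `A` as a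
substructure of `N` along an isomorphism. -/
theorem IsMuAEC.mem_of_leIn (hK : IsMuAEC K) (h : K.LeIn A B) :
    A.toStruc ∈ K.models ∧ B.toStruc ∈ K.models := by
  obtain ⟨h1, h2⟩ := hK.mem_of_le _ h.2
  refine ⟨hK.iso_mem _ _ h2 ⟨⟨⟨fun x => ⟨x.1.1, x.2⟩, fun x => ⟨⟨x.1, h.1 x.2⟩, x.2⟩,
    fun _ => rfl, fun _ => rfl⟩, fun _ _ => rfl, fun _ _ => Iff.rfl⟩⟩, h1⟩

theorem IsEmb.leIn (hK : IsMuAEC K) {P : Pair L} (hP : P ∈ K.le) {h : P.big.carrier → N.carrier}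
    (hh : IsEmb P.big N h) (hB : Set.range h = B.carrier)
    (hA : h '' P.small.carrier = A.carrier) : K.LeIn A B := by
  refine ⟨?_, hK.iso_le _ _ hP (hh.pair_isIso hB hA)⟩
  rw [← hA, ← hB]
  exact Set.image_subset_range _ _

/-- Membership in the class of all members of a directed system follows from directedness, applied
to singletons. -/
theorem AbstractClass.IsDirectedSystem.of_leIn (hK : IsMuAEC K) (hμ : ℵ₀ ≤ μ) {I : Type u}
    {A : I → Substr N} (h : ∀ J : Set I, #J < μ → ∃ k, ∀ j ∈ J, K.LeIn (A j) (A k)) :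
    K.IsDirectedSystem A where
  mem i := by
    obtain ⟨k, hk⟩ := h {i} (by simpa using one_lt_aleph0.trans_le hμ)
    exact (hK.mem_of_leIn (hk i rfl)).1
  directed := h

end Strong

/-! ### Formulas and types -/

section Formulas

variable {α : Type u}

/-- Implication, as an abbreviation. -/
def Formula.imp (hμ : ℵ₀ ≤ μ) (φ ψ : Formula L α) : Formula L α :=
  .neg (.conj (ULift.{u} Bool) (by simpa using (natCast_lt_aleph0 (n := 2)).trans_le hμ)
    fun b => bif b.down then φ else .neg ψ)

theorem Formula.realize_imp (hμ : ℵ₀ ≤ μ) (φ ψ : Formula L α) (M : Struc L) (v : α → M.carrier) :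
    (φ.imp hμ ψ).Realize M v ↔ (φ.Realize M v → ψ.Realize M v) := by
  simp [Formula.imp, Formula.Realize, ULift.forall, Bool.forall_bool, imp_iff_not_or, or_comm]

open Classical in
/-- The formula `φ` or its negation, according to the truth value of `P`. -/
noncomputable def Formula.lit (P : Prop) (φ : Formula L α) : Formula L α :=
  if P then φ else .neg φ

theorem Formula.realize_lit (P : Prop) (φ : Formula L α) (M : Struc L) (v : α → M.carrier) :
    (φ.lit P).Realize M v ↔ (φ.Realize M v ↔ P) := by
  by_cases h : P <;> simp [Formula.lit, Formula.Realize, h]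

/-- The type which is omitted if and only if every tuple that satisfies `Φ` makes `t` equal to some
`u c`. -/
def avoidType (hα : #α < μ) (Φ : Set (Formula L α)) (t : Term L α) {ι : Type u} (u : ι → Term L α) :
    PType L :=
  ⟨α, hα, Φ ∪ Set.range fun c => .neg (.eq t (u c))⟩

theorem omits_avoidType {hα : #α < μ} {Φ : Set (Formula L α)} {t : Term L α} {ι : Type u}
    {u : ι → Term L α} {M : Struc L} : Omits M (avoidType hα Φ t u) ↔
      ∀ v : α → M.carrier, (∀ φ ∈ Φ, φ.Realize M v) → ∃ c, t.value M v = (u c).value M v := by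
  refine not_exists.trans (forall_congr' fun v => ?_)
  have : (∀ φ ∈ (avoidType hα Φ t u).formulas, φ.Realize M v) ↔
      (∀ φ ∈ Φ, φ.Realize M v) ∧ ∀ c, ¬ t.value M v = (u c).value M v := by
    change (∀ φ ∈ Φ ∪ Set.range fun c => Formula.neg (.eq t (u c)), φ.Realize M v) ↔ _
    simp only [Set.mem_union, or_imp, forall_and, Set.forall_mem_range, Formula.Realize]
    rfl
  rw [this, not_and, not_forall]
  simp only [not_not]
  rfl

/-- A type omitted by all structures, one for each symbol of the language. -/
def paddingType (L : InfLanguage μ) : L.Func ⊕ L.Rel → PType L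
  | .inl f => ⟨L.fArity f, L.fArity_lt f, {.neg (.eq (.func f .var) (.func f .var))}⟩
  | .inr R => ⟨L.rArity R, L.rArity_lt R, {.rel R .var, .neg (.rel R .var)}⟩

theorem omits_paddingType (s : L.Func ⊕ L.Rel) (M : Struc L) : Omits M (paddingType L s) := by
  rintro ⟨v, hv⟩
  rcases s with f | R
  · exact hv _ rfl rfl
  · exact hv _ (Or.inr rfl) (hv _ (Or.inl rfl))

/-- The symbol at the head of a formula of one of the forms which occur in `paddingType`. -/
def Formula.head : {α : Type u} → Formula L α → Option (L.Func ⊕ L.Rel)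
  | _, .rel R _ => some (.inr R)
  | _, .neg (.eq (.func f _) _) => some (.inl f)
  | _, _ => none

theorem paddingType_injective : Function.Injective (paddingType L) := by
  have key : ∀ s, {o | ∃ φ ∈ (paddingType L s).formulas, φ.head = some o} = {s} := by
    rintro (f | R) <;> ext o <;> constructor
    · rintro ⟨φ, rfl, h⟩
      exact (Option.some.inj h).symm
    · rintro rfl
      exact ⟨_, rfl, rfl⟩
    · rintro ⟨φ, rfl | rfl, h⟩
      · exact (Option.some.inj h).symm
      · cases h
    · rintro rfl
      exact ⟨_, Or.inl rfl, rfl⟩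
  intro s t h
  have := key s
  rw [h, key t] at this
  exact (Set.singleton_injective this).symm

end Formulas

/-! ### The expanded language -/

/-- The new symbols of the presentation. For every tuple `a` of length `i`, function symbols
indexed by `B` list a submodel `M_a`. For every reindexing `s` and every tuple `a` of length
`s.tgt`, further function symbols list `M_a` once more, and relation symbols name the isomorphism
type in `Q` of the pair `(M_{a ∘ s}, M_a)`. -/
def skolemLanguage (μ : Cardinal.{u}) (B Q : Type u) : InfLanguage μ where
  Func := (Idx μ × B) ⊕ (Reindexing μ × B)
  Rel := Reindexing μ × Q
  fArity := Sum.elim (fun x => Set.Iio x.1) (fun x => Set.Iio x.1.tgt)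
  rArity := fun x => Set.Iio x.1.tgt
  fArity_lt := by
    rintro (f | f) <;> exact mk_Iio_idx_lt _
  rArity_lt _ := mk_Iio_idx_lt _

variable {B Q : Type u}

section Values

variable (M : Struc (L.expand (skolemLanguage μ B Q)))

/-- The listing of the submodel `M_a`. -/
def Struc.hullFun (i : Idx μ) (a : Set.Iio i → M.carrier) (β : B) : M.carrier :=
  M.funMap (.inr (.inl (i, β))) a

/-- The listing of the submodel `M_a` which is adapted to the pair `(M_{a ∘ s}, M_a)`. -/
def Struc.pairFun (s : Reindexing μ) (a : Set.Iio s.tgt → M.carrier) (β : B) : M.carrier :=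
  M.funMap (.inr (.inr (s, β))) a

/-- The assertion that `(M_{a ∘ s}, M_a)` has the isomorphism type `q`. -/
def Struc.pairRel (s : Reindexing μ) (q : Q) (a : Set.Iio s.tgt → M.carrier) : Prop :=
  M.relMap (.inr (s, q)) a

end Values

section Terms

variable {α : Type u}

/-- The term for `Struc.hullFun`. -/
def hullTerm (L : InfLanguage μ) (Q : Type u) (i : Idx μ) (x : Set.Iio i → α) (β : B) :
    Term (L.expand (skolemLanguage μ B Q)) α :=
  .func (.inr (.inl (i, β))) fun k => .var (x k)

/-- The term for `Struc.pairFun`. -/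
def pairTerm (L : InfLanguage μ) (Q : Type u) (s : Reindexing μ) (x : Set.Iio s.tgt → α) (β : B) :
    Term (L.expand (skolemLanguage μ B Q)) α :=
  .func (.inr (.inr (s, β))) fun k => .var (x k)

/-- The atomic formula for `Struc.pairRel`. -/
def pairAtom (L : InfLanguage μ) (B : Type u) (s : Reindexing μ) (q : Q) (x : Set.Iio s.tgt → α) :
    Formula (L.expand (skolemLanguage μ B Q)) α :=
  .rel (.inr (s, q)) fun k => .var (x k)

end Terms

/-! ### The theory and the types -/

variable (p : Q → Pair L) (e : ∀ q, B ≃ (p q).big.carrier)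

/-- What the theory and the types of the presentation express. Here the pairs `p q` represent the
isomorphism types, and `e q` lists the larger member of `p q`. -/
structure IsPresentation (M : Struc (L.expand (skolemLanguage μ B Q))) : Prop where
  covers : ∀ (i : Idx μ) (a : Set.Iio i → M.carrier) (k : Set.Iio i), ∃ β, a k = M.hullFun i a β
  exists_rel : ∀ (s : Reindexing μ) (a : Set.Iio s.tgt → M.carrier), ∃ q, M.pairRel s q a
  hull_pair : ∀ (s : Reindexing μ) (a : Set.Iio s.tgt → M.carrier) (β : B),
    ∃ γ, M.hullFun s.tgt a β = M.pairFun s a γ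
  pair_hull : ∀ (s : Reindexing μ) (a : Set.Iio s.tgt → M.carrier) (γ : B),
    ∃ β, M.pairFun s a γ = M.hullFun s.tgt a β
  isEmb : ∀ (s : Reindexing μ) (q : Q) (a : Set.Iio s.tgt → M.carrier), M.pairRel s q a →
    IsEmb (p q).big M.reduct fun y => M.pairFun s a ((e q).symm y)
  small_pair : ∀ (s : Reindexing μ) (q : Q) (a : Set.Iio s.tgt → M.carrier), M.pairRel s q a →
    ∀ β, ∃ y : (p q).small.carrier,
      M.hullFun s.src (a ∘ s.map) β = M.pairFun s a ((e q).symm y)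
  pair_small : ∀ (s : Reindexing μ) (q : Q) (a : Set.Iio s.tgt → M.carrier), M.pairRel s q a →
    ∀ y : (p q).small.carrier, ∃ β,
      M.pairFun s a ((e q).symm y) = M.hullFun s.src (a ∘ s.map) β

/-- The indices for the diagram of a structure: the instances of its functions, of its relations
and of the equality relation. -/
abbrev DiagramIdx (N : Struc L) : Type u :=
  (Σ f : L.Func, L.fArity f → N.carrier) ⊕ (Σ R : L.Rel, L.rArity R → N.carrier) ⊕
    (N.carrier × N.carrier)

/-- The part `d` of the statement that the tuples which satisfy the relation symbol `(s, q)` list a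
copy of the larger member of `p q`. -/
noncomputable def diagramSentence (hμ : ℵ₀ ≤ μ) (s : Reindexing μ) (q : Q)
    (d : DiagramIdx (p q).big) : Sentence (L.expand (skolemLanguage μ B Q)) :=
  .all (Set.Iio s.tgt) (mk_Iio_idx_lt _) <| .imp hμ (pairAtom L B s q Sum.inr) <|
    match d with
    | .inl ⟨f, z⟩ => .eq (.func (.inl f) fun n => pairTerm L Q s Sum.inr ((e q).symm (z n)))
        (pairTerm L Q s Sum.inr ((e q).symm ((p q).big.funMap f z)))
    | .inr (.inl ⟨R, z⟩) => .lit ((p q).big.relMap R z)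
        (.rel (.inl R) fun n => pairTerm L Q s Sum.inr ((e q).symm (z n)))
    | .inr (.inr (y, z)) => .lit (y = z)
        (.eq (pairTerm L Q s Sum.inr ((e q).symm y)) (pairTerm L Q s Sum.inr ((e q).symm z)))

/-- The theory of the presentation. -/
def presentationTheory (hμ : ℵ₀ ≤ μ) : Set (Sentence (L.expand (skolemLanguage μ B Q))) :=
  Set.range fun x : Σ _ : Reindexing μ, Σ q : Q, DiagramIdx (p q).big =>
    diagramSentence p e hμ x.1 x.2.1 x.2.2

theorem realize_presentationTheory (hμ : ℵ₀ ≤ μ) (M : Struc (L.expand (skolemLanguage μ B Q))) :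
    (∀ φ ∈ presentationTheory p e hμ, φ.Realize M PEmpty.elim) ↔
      ∀ (s : Reindexing μ) (q : Q) (a : Set.Iio s.tgt → M.carrier), M.pairRel s q a →
        IsEmb (p q).big M.reduct fun y => M.pairFun s a ((e q).symm y) := by
  have key : ∀ s q d, (diagramSentence p e hμ s q d).Realize M PEmpty.elim ↔
      ∀ a : Set.Iio s.tgt → M.carrier, M.pairRel s q a →
        match d with
        | .inl ⟨f, z⟩ => M.reduct.funMap f (fun n => M.pairFun s a ((e q).symm (z n))) =
            M.pairFun s a ((e q).symm ((p q).big.funMap f z))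
        | .inr (.inl ⟨R, z⟩) => M.reduct.relMap R (fun n => M.pairFun s a ((e q).symm (z n))) ↔
            (p q).big.relMap R z
        | .inr (.inr (y, z)) =>
            M.pairFun s a ((e q).symm y) = M.pairFun s a ((e q).symm z) ↔ y = z := by
    intro s q d
    refine forall_congr' fun a => ?_
    rw [Formula.realize_imp]
    refine imp_congr_right fun _ => ?_
    rcases d with ⟨f, z⟩ | ⟨R, z⟩ | ⟨y, z⟩
    · rfl
    · exact Formula.realize_lit _ _ _ _
    · exact Formula.realize_lit _ _ _ _
  simp only [presentationTheory, Set.forall_mem_range, key, Sigma.forall]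
  constructor
  · intro h s q a ha
    exact ⟨fun y z hyz => (h s q (.inr (.inr (y, z))) a ha).1 hyz,
      fun f z => h s q (.inl ⟨f, z⟩) a ha, fun R z => h s q (.inr (.inl ⟨R, z⟩)) a ha⟩
  · intro h s q d a ha
    have := h s q a ha
    rcases d with ⟨f, z⟩ | ⟨R, z⟩ | ⟨y, z⟩
    · exact this.map_fun f z
    · exact this.map_rel R z
    · exact this.inj.eq_iff

/-- The types omitted in the presentation. The last ones are omitted by all structures; they are
there to make the number of types as large as the number of symbols. -/
def presentationTypes : Set (PType (L.expand (skolemLanguage μ B Q))) :=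
  (Set.range fun x : Σ i : Idx μ, Set.Iio i =>
    avoidType (mk_Iio_idx_lt x.1) ∅ (.var x.2) fun β : B => hullTerm L Q x.1 id β) ∪
  (Set.range fun s : Reindexing μ =>
    ⟨Set.Iio s.tgt, mk_Iio_idx_lt _, Set.range fun q : Q => .neg (pairAtom L B s q id)⟩) ∪
  (Set.range fun x : Reindexing μ × B =>
    avoidType (mk_Iio_idx_lt x.1.tgt) ∅ (hullTerm L Q x.1.tgt id x.2)
      fun γ : B => pairTerm L Q x.1 id γ) ∪
  (Set.range fun x : Reindexing μ × B =>
    avoidType (mk_Iio_idx_lt x.1.tgt) ∅ (pairTerm L Q x.1 id x.2)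
      fun β : B => hullTerm L Q x.1.tgt id β) ∪
  (Set.range fun x : Reindexing μ × Q × B =>
    avoidType (mk_Iio_idx_lt x.1.tgt) {pairAtom L B x.1 x.2.1 id}
      (hullTerm L Q x.1.src x.1.map x.2.2)
      fun y : (p x.2.1).small.carrier => pairTerm L Q x.1 id ((e x.2.1).symm y)) ∪
  (Set.range fun x : Reindexing μ × (Σ q : Q, (p q).small.carrier) =>
    avoidType (mk_Iio_idx_lt x.1.tgt) {pairAtom L B x.1 x.2.1 id}
      (pairTerm L Q x.1 id ((e x.2.1).symm x.2.2))
      fun β : B => hullTerm L Q x.1.src x.1.map β) ∪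
  Set.range (paddingType _)

theorem mem_EC_iff_isPresentation (hμ : ℵ₀ ≤ μ) (M : Struc (L.expand (skolemLanguage μ B Q))) :
    M ∈ EC (presentationTheory p e hμ) (presentationTypes p e) ↔ IsPresentation p e M := by
  have hrel : ∀ s : Reindexing μ,
      Omits M ⟨Set.Iio s.tgt, mk_Iio_idx_lt _, Set.range fun q : Q => .neg (pairAtom L B s q id)⟩ ↔
        ∀ a : Set.Iio s.tgt → M.carrier, ∃ q, M.pairRel s q a := by
    intro s
    simp only [Omits, Set.forall_mem_range, Formula.Realize, not_exists, not_forall, not_not]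
    rfl
  simp only [EC, Set.mem_ofPred_eq, realize_presentationTheory, presentationTypes, Set.mem_union,
    or_imp, forall_and, Set.forall_mem_range, omits_avoidType, omits_paddingType, hrel,
    Set.mem_empty_iff_false, IsEmpty.forall_iff, Set.mem_singleton_iff, forall_eq, Sigma.forall,
    Prod.forall, implies_true, forall_const, and_true]
  constructor
  · rintro ⟨h1, ⟨⟨⟨⟨⟨h2, h3⟩, h4⟩, h5⟩, h6⟩, h7⟩⟩
    exact ⟨fun i a k => h2 i k a, h3, fun s a β => h4 s β a, fun s a β => h5 s β a, h1,
      fun s q a ha β => h6 s q β a ha, fun s q a ha y => h7 s q y a ha⟩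
  · rintro ⟨h2, h3, h4, h5, h1, h6, h7⟩
    exact ⟨h1, ⟨⟨⟨⟨⟨fun i k a => h2 i a k, h3⟩, fun s β a => h4 s a β⟩, fun s β a => h5 s a β⟩,
      fun s q β a ha => h6 s q a ha β⟩, fun s q y a ha => h7 s q a ha y⟩⟩

variable {p e}

/-! ### Structures with a presentation belong to the class -/

/-- Fewer than `μ` tuples are reindexings of one longer tuple. This is where the regularity of `μ`
is used. -/
theorem exists_common_extension (hμ : μ.IsRegular) {X : Type u} [Nonempty X]
    (J : Set (Σ i : Idx μ, Set.Iio i → X)) (hJ : #J < μ) :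
    ∃ (k : Idx μ) (c : Set.Iio k → X), ∀ i a, ⟨i, a⟩ ∈ J →
      ∃ (_ : i < k) (m : Set.Iio i → Set.Iio k), a = c ∘ m := by
  have hα : #(Σ x : J, Set.Iio x.1.1) < μ := by
    rw [mk_sigma]
    exact sum_lt_of_isRegular hμ hJ fun x => mk_Iio_idx_lt _
  obtain ⟨k, hk, ⟨g⟩⟩ := exists_index hμ (T := Sigma.fst '' J) (mk_image_le.trans_lt hJ) hα
  refine ⟨k, Function.extend g (fun y => y.1.1.2 y.2) fun _ => Classical.arbitrary X,
    fun i a hx => ⟨hk _ ⟨_, hx, rfl⟩, fun l => g ⟨⟨⟨i, a⟩, hx⟩, l⟩, ?_⟩⟩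
  funext l
  exact (g.injective.extend_apply (fun y => y.1.1.2 y.2) _ ⟨⟨⟨i, a⟩, hx⟩, l⟩).symm

/-- The conditions on a presentation are universal, so they pass to substructures. -/
theorem IsPresentation.toStruc {M : Struc (L.expand (skolemLanguage μ B Q))}
    (h : IsPresentation p e M) (A : Substr M) : IsPresentation p e A.toStruc where
  covers i a k := (h.covers i (fun k => (a k).1) k).imp fun _ h => Subtype.ext h
  exists_rel s a := h.exists_rel s fun k => (a k).1
  hull_pair s a β := (h.hull_pair s (fun k => (a k).1) β).imp fun _ h => Subtype.ext h
  pair_hull s a β := (h.pair_hull s (fun k => (a k).1) β).imp fun _ h => Subtype.ext h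
  isEmb s q a ha :=
    have h1 := h.isEmb s q (fun k => (a k).1) ha
    ⟨fun _ _ hyz => h1.inj (congrArg Subtype.val hyz), fun f x => Subtype.ext (h1.map_fun f x),
      h1.map_rel⟩
  small_pair s q a ha β :=
    (h.small_pair s q (fun k => (a k).1) ha β).imp fun _ h => Subtype.ext h
  pair_small s q a ha y :=
    (h.pair_small s q (fun k => (a k).1) ha y).imp fun _ h => Subtype.ext h

section Soundness

variable {M : Struc (L.expand (skolemLanguage μ B Q))}

theorem IsPresentation.range_pairFun (h : IsPresentation p e M) {s : Reindexing μ} {q : Q}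
    {a : Set.Iio s.tgt → M.carrier} :
    (Set.range fun y => M.pairFun s a ((e q).symm y)) = Set.range (M.hullFun s.tgt a) := by
  ext x
  constructor
  · rintro ⟨y, rfl⟩
    exact (h.pair_hull s a _).imp fun _ h => h.symm
  · rintro ⟨β, rfl⟩
    obtain ⟨γ, hγ⟩ := h.hull_pair s a β
    exact ⟨e q γ, by simp [hγ]⟩

theorem IsPresentation.image_small (h : IsPresentation p e M) {s : Reindexing μ} {q : Q}
    {a : Set.Iio s.tgt → M.carrier}
    (ha : M.pairRel s q a) : (fun y => M.pairFun s a ((e q).symm y)) '' (p q).small.carrier =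
      Set.range (M.hullFun s.src (a ∘ s.map)) := by
  ext x
  constructor
  · rintro ⟨y, hy, rfl⟩
    exact (h.pair_small s q a ha ⟨y, hy⟩).imp fun _ h => h.symm
  · rintro ⟨β, rfl⟩
    obtain ⟨y, hy⟩ := h.small_pair s q a ha β
    exact ⟨y, y.2, hy.symm⟩

variable [Nonempty B]

theorem nonempty_of_substr (hμ : μ.IsRegular) (S : Substr M) :
    Nonempty S.carrier := by
  obtain ⟨j, -⟩ := exists_index hμ (T := ∅) (α := PEmpty.{u + 1}) (by simpa using hμ.pos)
    (by simpa using hμ.pos)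
  obtain ⟨i, -, hi⟩ := wellFounded_lt.has_min (Set.univ : Set (Idx μ)) ⟨j, trivial⟩
  exact ⟨_, S.closed (.inr (.inl (i, Classical.arbitrary B)))
    (fun k => absurd k.2 (hi _ trivial)) fun k => absurd k.2 (hi _ trivial)⟩

/-- The submodel `M_a`. -/
def IsPresentation.hull (h : IsPresentation p e M) (hμ : μ.IsRegular)
    (i : Idx μ) (a : Set.Iio i → M.carrier) : Substr M.reduct where
  carrier := Set.range (M.hullFun i a)
  closed := by
    obtain ⟨⟨x⟩⟩ := nonempty_of_substr hμ (Substr.whole M)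
    have : Nonempty M.carrier := ⟨x⟩
    obtain ⟨k, c, hc⟩ := exists_common_extension hμ {(⟨i, a⟩ : Σ i : Idx μ, Set.Iio i → M.carrier)}
      (by simpa using hμ.nat_lt 1)
    obtain ⟨hik, m, hm⟩ := hc _ _ rfl
    subst hm
    obtain ⟨q, hq⟩ := h.exists_rel ⟨i, k, hik, m⟩ c
    have hA := Set.ext_iff.1 (h.image_small hq)
    have hclosed := ((h.isEmb ⟨i, k, hik, m⟩ q c hq).image (p q).small).closed
    exact fun f x hx => (hA _).1 (hclosed f x fun n => (hA _).2 (hx n))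

variable {K : AbstractClass L}

theorem IsPresentation.hull_leIn (h : IsPresentation p e M) (hμ : μ.IsRegular)
    (hK : IsMuAEC K) (hp : ∀ q, p q ∈ K.le) (s : Reindexing μ)
    (a : Set.Iio s.tgt → M.carrier) :
    K.LeIn (h.hull hμ s.src (a ∘ s.map)) (h.hull hμ s.tgt a) := by
  obtain ⟨q, hq⟩ := h.exists_rel s a
  exact (h.isEmb s q a hq).leIn hK (hp q) h.range_pairFun (h.image_small hq)

theorem IsPresentation.isDirectedSystem (h : IsPresentation p e M) (hμ : μ.IsRegular)
    (hK : IsMuAEC K) (hp : ∀ q, p q ∈ K.le) (S : Substr M) :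
    K.IsDirectedSystem fun x : Σ i : Idx μ, Set.Iio i → S.carrier =>
      h.hull hμ x.1 fun k => (x.2 k).1 := by
  have := nonempty_of_substr hμ S
  refine .of_leIn hK hμ.aleph0_le fun J hJ => ?_
  obtain ⟨k, c, hc⟩ := exists_common_extension hμ J hJ
  refine ⟨⟨k, c⟩, ?_⟩
  rintro ⟨i, a⟩ hx
  obtain ⟨hik, m, hm⟩ := hc _ _ hx
  subst hm
  exact h.hull_leIn hμ hK hp ⟨i, k, hik, m⟩ fun l => (c l).1

theorem IsPresentation.iUnion_hull (h : IsPresentation p e M) (hμ : μ.IsRegular) (S : Substr M) :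
    (⋃ x : Σ i : Idx μ, Set.Iio i → S.carrier, (h.hull hμ x.1 fun k => (x.2 k).1).carrier) =
      S.carrier := by
  ext y
  simp only [Set.mem_iUnion]
  constructor
  · rintro ⟨x, β, rfl⟩
    exact S.closed (.inr (.inl (x.1, β))) _ fun k => (x.2 k).2
  · intro hy
    obtain ⟨i, -, ⟨g⟩⟩ := exists_index hμ (T := ∅) (α := PUnit.{u + 1}) (by simpa using hμ.pos)
      (by simpa using hμ.nat_lt 1)
    obtain ⟨β, hβ⟩ := h.covers i (fun _ => y) (g ⟨⟩)
    exact ⟨⟨i, fun _ => ⟨y, hy⟩⟩, β, hβ.symm⟩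

theorem IsPresentation.reduct_mem_and_hull_le (h : IsPresentation p e M) (hμ : μ.IsRegular)
    (hK : IsMuAEC K) (hp : ∀ q, p q ∈ K.le) :
    M.reduct ∈ K.models ∧
    ∀ (i : Idx μ) (a : Set.Iio i → M.carrier), (⟨M.reduct, h.hull hμ i a⟩ : Pair L) ∈ K.le := by
  obtain ⟨h1, h2⟩ := hK.directed_union M.reduct _ _
    (h.isDirectedSystem hμ hK hp (Substr.whole M)) (h.iUnion_hull hμ (Substr.whole M))
  exact ⟨h1, fun i a => h2 ⟨i, fun k => ⟨a k, trivial⟩⟩⟩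

theorem IsPresentation.reduct_le (h : IsPresentation p e M) (hμ : μ.IsRegular)
    (hK : IsMuAEC K) (hp : ∀ q, p q ∈ K.le) (S : Substr M) : Pair.reduct ⟨M, S⟩ ∈ K.le := by
  obtain ⟨h1, h2⟩ := h.reduct_mem_and_hull_le hμ hK hp
  exact hK.directed_le M.reduct _ _ (Pair.reduct ⟨M, S⟩).small h1
    (h.isDirectedSystem hμ hK hp S) (fun x => h2 _ _) (h.iUnion_hull hμ S)

theorem IsPresentation.mk_le_mk_carrier (h : IsPresentation p e M) (hμ : μ.IsRegular) :
    #B ≤ #M.carrier := by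
  obtain ⟨⟨x, -⟩⟩ := nonempty_of_substr hμ (Substr.whole M)
  obtain ⟨j, -⟩ := exists_index hμ (T := ∅) (α := PEmpty.{u + 1}) (by simpa using hμ.pos)
    (by simpa using hμ.pos)
  have : Nonempty M.carrier := ⟨x⟩
  obtain ⟨k, c, hc⟩ := exists_common_extension hμ
    {(⟨j, fun _ => x⟩ : Σ i : Idx μ, Set.Iio i → M.carrier)} (by simpa using hμ.nat_lt 1)
  obtain ⟨hjk, m, -⟩ := hc _ _ rfl
  obtain ⟨q, hq⟩ := h.exists_rel ⟨j, k, hjk, m⟩ c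
  exact mk_le_of_injective ((h.isEmb ⟨j, k, hjk, m⟩ q c hq).inj.comp (e q).injective)

end Soundness

variable {K : AbstractClass L} {κ : Cardinal.{u}}

/-! ### Members of the class have presentations -/

theorem mk_iUnion_le_of_le {α ι : Type u} {f : ι → Set α} {κ κ' : Cardinal.{u}}
    (hι : #ι ≤ κ) (hf : ∀ i, #(f i) ≤ κ') : #(⋃ i, f i) ≤ κ * κ' := by
  refine mk_iUnion_le_sum_mk.trans ?_
  rw [← mk_sigma]
  exact mk_sigma_le_of_le hι hf

theorem AbstractClass.HasLS.le_card (h : K.HasLS κ) : μ ≤ κ :=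
  le_add_self.trans h.2.1

theorem AbstractClass.HasLS.exists_le_mk_eq (hκ : K.HasLS κ) (hμ : ℵ₀ ≤ μ) {M : Struc L}
    (hM : M ∈ K.models) (hMκ : κ ≤ #M.carrier) (X : Set M.carrier) (hX : #X ≤ κ) :
    ∃ A : Substr M, X ⊆ A.carrier ∧ (⟨M, A⟩ : Pair L) ∈ K.le ∧ #A.carrier = κ := by
  have h0 : ℵ₀ ≤ κ := hμ.trans hκ.le_card
  obtain ⟨Y, hY⟩ := le_mk_iff_exists_set.1 hMκ
  have hXY : #(X ∪ Y : Set M.carrier) ≤ κ :=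
    (mk_union_le X Y).trans (add_le_of_le h0 hX hY.le)
  obtain ⟨A, hA, hAM, hAκ⟩ := hκ.2.2 M hM (X ∪ Y)
  refine ⟨A, Set.subset_union_left.trans hA, hAM, le_antisymm (hAκ.trans ?_) ?_⟩
  · refine add_le_of_le h0 ?_ le_rfl
    exact powerlt_le.2 fun c hc => (power_le_power_right hXY).trans
      ((le_powerlt κ hc).trans_eq hκ.1)
  · exact hY.symm.trans_le (mk_le_mk_of_subset (Set.subset_union_right.trans hA))

/-- The Löwenheim–Skolem property for a pair: a set of elements of the smaller member is contained
in a strong submodel of the smaller member. -/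
theorem AbstractClass.HasLS.exists_le_of_pair (hκ : K.HasLS κ) (hμ : ℵ₀ ≤ μ) (hK : IsMuAEC K)
    {N : Struc L} {S : Substr N} (hS : (⟨N, S⟩ : Pair L) ∈ K.le) (hSκ : κ ≤ #S.carrier)
    (X : Set N.carrier) (hX : #X ≤ κ) :
    ∃ A : Substr N, X ⊆ A.carrier ∧ (⟨N, A⟩ : Pair L) ∈ K.le ∧ #A.carrier = κ ∧
      (X ⊆ S.carrier → A.carrier ⊆ S.carrier) := by
  obtain ⟨hN, hSK⟩ := hK.mem_of_le _ hS
  by_cases hXS : X ⊆ S.carrier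
  · obtain ⟨A, hXA, hA, hAκ⟩ := hκ.exists_le_mk_eq hμ hSK hSκ
      ((fun x : S.carrier => (x : N.carrier)) ⁻¹' X)
      ((mk_preimage_of_injective _ _ Subtype.val_injective).trans hX)
    have hsub : (S.isEmb_coe.image A).carrier ⊆ S.carrier := by
      rintro _ ⟨x, -, rfl⟩
      exact x.2
    have hwithin : (S.isEmb_coe.image A).within S = A := by
      ext x
      exact S.isEmb_coe.inj.mem_set_image
    refine ⟨S.isEmb_coe.image A, fun x hx => ⟨⟨x, hXS hx⟩, hXA hx, rfl⟩,
      hK.le_trans N _ S ⟨hsub, ?_⟩ hS, (mk_image_eq S.isEmb_coe.inj).trans hAκ, fun _ => hsub⟩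
    rwa [hwithin]
  · obtain ⟨A, hXA, hA, hAκ⟩ := hκ.exists_le_mk_eq hμ hN (hSκ.trans (mk_set_le _)) X hX
    exact ⟨A, hXA, hA, hAκ, fun h => absurd h hXS⟩

/-- From an operator `G` which extends sets to substructures, substructures `M_a ∋ a` for all tuples
`a`, such that `M_{a ∘ s} ⊆ M_a` for all reindexings `s`. The recursion is on the length of `a`:
inclusion of the ranges of tuples is not well-founded if `μ` is uncountable. -/
noncomputable def tower {N : Struc L} (G : Set N.carrier → Substr N) :
    (i : Idx μ) → (Set.Iio i → N.carrier) → Substr N := fun i a =>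
  G (Set.range a ∪ ⋃ x : Σ j : Set.Iio i, (Set.Iio j.1 → Set.Iio i),
    (tower G x.1.1 (a ∘ x.2)).carrier)
termination_by i => i
decreasing_by exact x.1.2

theorem AbstractClass.HasLS.exists_tower (hκ : K.HasLS κ) (hμ : ℵ₀ ≤ μ) (hK : IsMuAEC K)
    {N : Struc L} {S : Substr N} (hS : (⟨N, S⟩ : Pair L) ∈ K.le) (hSκ : κ ≤ #S.carrier) :
    ∃ H : (i : Idx μ) → (Set.Iio i → N.carrier) → Substr N,
      (∀ i a k, a k ∈ (H i a).carrier) ∧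
      (∀ (s : Reindexing μ) a, (H s.src (a ∘ s.map)).carrier ⊆ (H s.tgt a).carrier) ∧
      (∀ i a, (⟨N, H i a⟩ : Pair L) ∈ K.le) ∧ (∀ i a, #(H i a).carrier = κ) ∧
      ∀ i a, (∀ k, a k ∈ S.carrier) → (H i a).carrier ⊆ S.carrier := by
  have h0 : ℵ₀ ≤ κ := hμ.trans hκ.le_card
  have : Nonempty (Substr N) := ⟨S⟩
  choose! G hXG hG hGκ hGS using hκ.exists_le_of_pair hμ hK hS hSκ
  let X (i : Idx μ) (a : Set.Iio i → N.carrier) : Set N.carrier :=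
    Set.range a ∪ ⋃ x : Σ j : Set.Iio i, (Set.Iio j.1 → Set.Iio i),
      (tower G x.1.1 (a ∘ x.2)).carrier
  have heq : ∀ i a, tower G i a = G (X i a) := fun i a => by rw [tower]
  have hX : ∀ i a, #(X i a) ≤ κ := by
    intro i
    induction i using WellFoundedLT.induction with
    | ind i ih =>
      intro a
      refine (mk_union_le _ _).trans (add_le_of_le h0 ?_ ?_)
      · exact mk_range_le.trans ((mk_Iio_idx_lt i).le.trans hκ.le_card)
      · rw [← mul_eq_self h0]
        refine mk_iUnion_le_of_le ?_ fun x => ?_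
        · rw [← mul_eq_self h0]
          exact mk_sigma_le_of_le ((mk_Iio_idx_lt i).le.trans hκ.le_card) fun j =>
            mk_fun_le_of_powerlt hκ.1 (mk_Iio_idx_lt _) ((mk_Iio_idx_lt i).le.trans hκ.le_card)
        · rw [heq]
          exact (hGκ _ (ih _ x.1.2 _)).le
  have hsub : ∀ i a, X i a ⊆ (tower G i a).carrier := fun i a => by
    rw [heq]
    exact hXG _ (hX i a)
  refine ⟨tower G, fun i a k => hsub i a (Or.inl ⟨k, rfl⟩), fun s a => ?_, fun i a => ?_,
    fun i a => ?_, fun i => ?_⟩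
  · exact fun y hy => hsub _ _ (Or.inr (Set.mem_iUnion.2 ⟨⟨⟨s.src, s.lt⟩, s.map⟩, hy⟩))
  · rw [heq]
    exact hG _ (hX i a)
  · rw [heq]
    exact hGκ _ (hX i a)
  · induction i using WellFoundedLT.induction with
    | ind i ih =>
      intro a ha
      rw [heq]
      refine hGS _ (hX i a) (Set.union_subset ?_ (Set.iUnion_subset fun x => ?_))
      · rintro _ ⟨k, rfl⟩
        exact ha k
      · exact ih _ x.1.2 _ fun k => ha _

/-- A pair `M ≤ N` expands to a pair of presentations, if the pairs `p q` represent all isomorphism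
types of pairs of cardinality `κ`. -/
theorem AbstractClass.HasLS.exists_isPresentation (hκ : K.HasLS κ) (hμ : ℵ₀ ≤ μ) (hK : IsMuAEC K)
    (hB : #B = κ) (hp : ∀ P ∈ K.le, #P.big.carrier = κ → #P.small.carrier = κ →
      ∃ q, (p q).IsIso P) (P : Pair L) (hP : P ∈ K.le) (hPκ : κ ≤ #P.small.carrier) :
    ∃ P' : Pair (L.expand (skolemLanguage μ B Q)), IsPresentation p e P'.big ∧ P'.reduct = P := by
  obtain ⟨N, S⟩ := P
  obtain ⟨H, haH, hHmono, hHle, hHκ, hHS⟩ := hκ.exists_tower hμ hK hP hPκ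
  have hE : ∀ i a, Nonempty (B ≃ (H i a).carrier) := fun i a =>
    Cardinal.eq.1 (hB.trans (hHκ i a).symm)
  let E i a := (hE i a).some
  have hpair : ∀ (s : Reindexing μ) (a : Set.Iio s.tgt → N.carrier),
      ∃ (q : Q) (g : (p q).big.carrier → N.carrier), IsEmb (p q).big N g ∧
        Set.range g = (H s.tgt a).carrier ∧
        g '' (p q).small.carrier = (H s.src (a ∘ s.map)).carrier := by
    intro s a
    have hle := hK.coherence N _ _ (hHle s.src (a ∘ s.map)) (hHle s.tgt a) (hHmono s a)
    obtain ⟨q, hq⟩ := hp _ hle.2 (hHκ _ _) <| by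
      rw [← hHκ s.src (a ∘ s.map)]
      exact Cardinal.mk_congr ⟨fun x => ⟨x.1.1, x.2⟩, fun x => ⟨⟨x.1, hle.1 x.2⟩, x.2⟩,
        fun _ => rfl, fun _ => rfl⟩
    obtain ⟨g, hg⟩ := hq.exists_isEmb hle.1
    exact ⟨q, g, hg⟩
  choose q g hg hgH hgsmall using hpair
  let N' : Struc (L.expand (skolemLanguage μ B Q)) :=
    { carrier := N.carrier
      funMap := fun f => match f with
        | .inl f => N.funMap f
        | .inr (.inl (i, β)) => fun a => (E i a β).1
        | .inr (.inr (s, β)) => fun a => g s a (e _ β)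
      relMap := fun R => match R with
        | .inl R => N.relMap R
        | .inr (s, q') => fun a => q' = q s a }
  have hE_range : ∀ i a x, x ∈ (H i a).carrier → ∃ β, x = N'.hullFun i a β := fun i a x hx =>
    ⟨(E i a).symm ⟨x, hx⟩, (congrArg Subtype.val ((E i a).apply_symm_apply ⟨x, hx⟩)).symm⟩
  have hg_eq : ∀ s a y, N'.pairFun s a ((e (q s a)).symm y) = g s a y := fun s a y =>
    congrArg (g s a) ((e _).apply_symm_apply y)
  have hN' : IsPresentation p e N' :=
    { covers := fun i a k => hE_range i a _ (haH i a k)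
      exists_rel := fun s a => ⟨q s a, rfl⟩
      hull_pair := fun s a β => by
        obtain ⟨y, hy⟩ : (E s.tgt a β).1 ∈ Set.range (g s a) := by
          rw [hgH]
          exact (E s.tgt a β).2
        exact ⟨(e _).symm y, hy.symm.trans (hg_eq s a y).symm⟩
      pair_hull := fun s a γ => hE_range _ _ _ (by
        rw [← hgH]
        exact ⟨_, rfl⟩)
      isEmb := by
        rintro s _ a rfl
        simp only [hg_eq]
        exact hg s a
      small_pair := by
        rintro s _ a rfl β
        obtain ⟨y, hy, hyβ⟩ : (E s.src (a ∘ s.map) β).1 ∈ g s a '' (p (q s a)).small.carrier := by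
          rw [hgsmall]
          exact (E s.src (a ∘ s.map) β).2
        exact ⟨⟨y, hy⟩, hyβ.symm.trans (hg_eq s a y).symm⟩
      pair_small := by
        rintro s _ a rfl y
        rw [hg_eq]
        exact hE_range _ _ _ (hgsmall s a ▸ Set.mem_image_of_mem _ y.2) }
  refine ⟨⟨N', S.carrier, ?_⟩, hN', rfl⟩
  rintro (f | ⟨i, β⟩ | ⟨s, β⟩) a ha
  · exact S.closed f a ha
  · exact hHS i a ha (E i a β).2
  · exact hHS s.tgt a ha ((hgH s a).subset ⟨e _ β, rfl⟩)

/-! ### Counting pairs, symbols, sentences and types -/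

/-- Isomorphism types form a small type: a structure of cardinality `κ` is isomorphic to one with
a fixed universe. -/
theorem small_quotient_pairSetoid (K : AbstractClass L) (κ : Cardinal.{u}) :
    Small.{u} (Quotient (K.pairSetoid κ)) := by
  have hE : ∀ P : K.PairsOfCard κ, Nonempty (κ.out ≃ P.1.big.carrier) := fun P =>
    Cardinal.eq.1 ((mk_out κ).trans P.2.2.1.symm)
  let E P := (hE P).some
  let code (P : K.PairsOfCard κ) : ((f : L.Func) → (L.fArity f → κ.out) → κ.out) ×
      ((R : L.Rel) → (L.rArity R → κ.out) → Prop) × Set κ.out :=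
    (fun f x => (E P).symm (P.1.big.funMap f fun i => E P (x i)),
      fun R x => P.1.big.relMap R fun i => E P (x i), E P ⁻¹' P.1.small.carrier)
  have hcode : ∀ P P', code P = code P' → P.1.IsIso P'.1 := by
    intro P P' h
    obtain ⟨hf, hR, hS⟩ := by simpa only [code, Prod.mk.injEq] using h
    refine ⟨⟨(E P).symm.trans (E P'), fun f x => ?_, fun R x => ?_⟩, fun x => ?_⟩
    · have := congrArg (E P') (congrFun (congrFun hf f) fun i => (E P).symm (x i))
      simpa using this
    · have := congrFun (congrFun hR R) fun i => (E P).symm (x i)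
      simpa using this
    · have := Set.ext_iff.1 hS ((E P).symm x)
      simpa using this
  refine small_of_injective (f := fun c => code c.out) fun c d h => ?_
  rw [← Quotient.out_eq c, ← Quotient.out_eq d]
  exact Quotient.sound (hcode _ _ h)

section Counting

variable (p e)

theorem card_expand_skolemLanguage (hκ : K.HasLS κ) (hμ : μ.IsRegular) (hB : #B = κ) :
    (L.expand (skolemLanguage μ B Q)).card = κ + #Q := by
  have h0 : ℵ₀ ≤ κ := hμ.aleph0_le.trans hκ.le_card
  have h1 : ℵ₀ ≤ κ + #Q := h0.trans le_self_add
  have hI : #(Idx μ) ≤ κ + #Q := by simpa using hκ.le_card.trans le_self_add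
  have hR : #(Reindexing μ) ≤ κ + #Q :=
    (mk_reindexing_le hμ.aleph0_le hκ.1 hκ.le_card).trans le_self_add
  have hB' : #B ≤ κ + #Q := hB.trans_le le_self_add
  have hL : L.card ≤ κ + #Q := (le_self_add.trans hκ.2.1).trans le_self_add
  obtain ⟨i, -⟩ := exists_index hμ (T := ∅) (α := PEmpty.{u + 1}) (by simpa using hμ.pos)
    (by simpa using hμ.pos)
  obtain ⟨k, hk, ⟨m⟩⟩ := exists_index hμ (T := {i}) (by simpa using hμ.nat_lt 1) (mk_Iio_idx_lt i)
  have hR1 : 1 ≤ #(Reindexing μ) :=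
    Cardinal.one_le_iff_ne_zero.2 (mk_ne_zero_iff.2 ⟨⟨i, k, hk i rfl, m⟩⟩)
  have hI1 : 1 ≤ #(Idx μ) := Cardinal.one_le_iff_ne_zero.2 (mk_ne_zero_iff.2 ⟨i⟩)
  have hcard : (L.expand (skolemLanguage μ B Q)).card =
      (#L.Func + (#(Idx μ) * #B + #(Reindexing μ) * #B)) + (#L.Rel + #(Reindexing μ) * #Q) := by
    simp [InfLanguage.card, InfLanguage.expand, skolemLanguage]
  rw [hcard]
  refine le_antisymm ?_ (add_le_add ?_ ?_)
  · refine add_le_of_le h1 (add_le_of_le h1 (le_self_add.trans hL) (add_le_of_le h1 ?_ ?_))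
      (add_le_of_le h1 (le_add_self.trans hL) ?_)
    · exact mul_le_of_le h1 hI hB'
    · exact mul_le_of_le h1 hR hB'
    · exact mul_le_of_le h1 hR le_add_self
  · rw [← hB]
    exact (le_mul_of_one_le_left' hI1).trans (le_self_add.trans le_add_self)
  · exact (le_mul_of_one_le_left' hR1).trans le_add_self

theorem mk_diagramIdx_le (hκ : K.HasLS κ) (hμ : ℵ₀ ≤ μ) {N : Struc L} (hN : #N.carrier = κ) :
    #(DiagramIdx N) ≤ κ := by
  have h0 : ℵ₀ ≤ κ := hμ.trans hκ.le_card
  have hL : L.card ≤ κ := le_self_add.trans hκ.2.1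
  simp only [DiagramIdx, mk_sum, lift_id, mk_prod]
  refine add_le_of_le h0 ?_ (add_le_of_le h0 ?_ (mul_le_of_le h0 hN.le hN.le))
  · rw [← mul_eq_self h0]
    exact mk_sigma_le_of_le (le_self_add.trans hL) fun f =>
      mk_fun_le_of_powerlt hκ.1 (L.fArity_lt f) hN.le
  · rw [← mul_eq_self h0]
    exact mk_sigma_le_of_le (le_add_self.trans hL) fun R =>
      mk_fun_le_of_powerlt hκ.1 (L.rArity_lt R) hN.le

theorem mk_range_le_lift_of_le {I : Type u} {X : Type (u + 1)} (f : I → X) (hI : #I ≤ κ) :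
    #(Set.range f) ≤ Cardinal.lift.{u + 1} κ := by
  have := mk_range_le_lift (f := f)
  rw [lift_id'.{u, u + 1}] at this
  exact this.trans (lift_le.2 hI)

theorem mk_presentationTheory_le (hκ : K.HasLS κ) (hμ : ℵ₀ ≤ μ) (hB : #B = κ) :
    #(presentationTheory p e hμ) ≤ Cardinal.lift.{u + 1} (κ + #Q) := by
  have h1 : ℵ₀ ≤ κ + #Q := (hμ.trans hκ.le_card).trans le_self_add
  refine mk_range_le_lift_of_le _ ?_
  rw [← mul_eq_self h1]
  refine mk_sigma_le_of_le ((mk_reindexing_le hμ hκ.1 hκ.le_card).trans le_self_add) fun _ => ?_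
  rw [← mul_eq_self h1]
  exact mk_sigma_le_of_le le_add_self fun q =>
    (mk_diagramIdx_le hκ hμ ((Cardinal.mk_congr (e q)).symm.trans hB)).trans le_self_add

theorem mk_presentationTypes (hκ : K.HasLS κ) (hμ : μ.IsRegular) (hB : #B = κ) :
    #(presentationTypes p e) = Cardinal.lift.{u + 1} (κ + #Q) := by
  have h0 : ℵ₀ ≤ κ := hμ.aleph0_le.trans hκ.le_card
  have h1 : ℵ₀ ≤ κ + #Q := h0.trans le_self_add
  have h2 : ℵ₀ ≤ Cardinal.lift.{u + 1} (κ + #Q) := aleph0_le_lift.2 h1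
  have hI : #(Idx μ) ≤ κ + #Q := by simpa using hκ.le_card.trans le_self_add
  have hR : #(Reindexing μ) ≤ κ + #Q :=
    (mk_reindexing_le hμ.aleph0_le hκ.1 hκ.le_card).trans le_self_add
  have hB' : #B ≤ κ + #Q := hB.trans_le le_self_add
  have hQ : #Q ≤ κ + #Q := le_add_self
  have hpad : #((L.expand (skolemLanguage μ B Q)).Func ⊕ (L.expand (skolemLanguage μ B Q)).Rel) =
      κ + #Q := by
    rw [← card_expand_skolemLanguage hκ hμ hB, mk_sum, lift_id, lift_id, InfLanguage.card]
  refine le_antisymm ?_ ?_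
  · iterate 6 refine (mk_union_le _ _).trans (add_le_of_le h2 ?_ ?_)
    · refine mk_range_le_lift_of_le _ ?_
      rw [← mul_eq_self h1]
      exact mk_sigma_le_of_le hI fun i => ((mk_Iio_idx_lt i).le.trans hκ.le_card).trans le_self_add
    · exact mk_range_le_lift_of_le _ hR
    · exact mk_range_le_lift_of_le _ (by simpa using mul_le_of_le h1 hR hB')
    · exact mk_range_le_lift_of_le _ (by simpa using mul_le_of_le h1 hR hB')
    · exact mk_range_le_lift_of_le _
        (by simpa using mul_le_of_le h1 hR (mul_le_of_le h1 hQ hB'))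
    · refine mk_range_le_lift_of_le _ ?_
      rw [mk_prod, lift_id, lift_id]
      refine mul_le_of_le h1 hR ?_
      rw [← mul_eq_self h1]
      exact mk_sigma_le_of_le hQ fun q =>
        ((mk_set_le _).trans_eq (Cardinal.mk_congr (e q)).symm).trans hB'
    · exact mk_range_le_lift_of_le _ hpad.le
  · have h := mk_range_eq_of_injective
      (paddingType_injective (L := L.expand (skolemLanguage μ B Q)))
    rw [lift_id'.{u, u + 1}, hpad] at h
    rw [← h]
    exact mk_le_mk_of_subset Set.subset_union_right

end Counting

end MuAEC

open MuAEC
theorem theorem5p6 {μ : Cardinal.{u}} (hμ : μ.IsRegular) (L : InfLanguage μ)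
    (K : AbstractClass L) (hK : IsMuAEC K)
    (χ : Cardinal.{u + 1}) (hχ : χ = Cardinal.lift.{u + 1} K.LS + K.I₂ K.LS) :
    ∃ (E : InfLanguage μ) (T : Set (Sentence (L.expand E))) (Γ : Set (PType (L.expand E))),
      Cardinal.lift.{u + 1} (L.expand E).card = χ ∧ #T ≤ χ ∧ #Γ = χ ∧
      {M ∈ K.models | K.LS ≤ #M.carrier} = PC T Γ ∧
      (∀ P : Pair (L.expand E), P.big ∈ EC T Γ → P.small.toStruc ∈ EC T Γ →
        P.reduct ∈ K.le) ∧
      (∀ P : Pair L, P ∈ K.le → K.LS ≤ #P.small.carrier → K.LS ≤ #P.big.carrier →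
        ∃ P' : Pair (L.expand E), P'.big ∈ EC T Γ ∧ P'.small.toStruc ∈ EC T Γ ∧
          P'.reduct = P) := by
  have hLS : K.HasLS K.LS := csInf_mem (s := {κ | K.HasLS κ}) hK.exists_LS
  generalize K.LS = κ at *
  have hsmall := small_quotient_pairSetoid K κ
  -- `p q` represents the isomorphism type `q`, and `e q` lists its larger member.
  let c (q : Shrink.{u} (Quotient (K.pairSetoid κ))) : K.PairsOfCard κ :=
    ((equivShrink _).symm q).out
  let p q := (c q).1
  have hB : #κ.out = κ := mk_out κ
  have hE : ∀ q, Nonempty (κ.out ≃ (p q).big.carrier) := fun q =>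
    Cardinal.eq.1 (hB.trans (c q).2.2.1.symm)
  let e q := (hE q).some
  have : Nonempty κ.out := by
    rw [← mk_ne_zero_iff, hB]
    exact (hμ.pos.trans_le hLS.le_card).ne'
  have hp : ∀ q, p q ∈ K.le := fun q => (c q).2.1
  have hp' : ∀ P ∈ K.le, #P.big.carrier = κ → #P.small.carrier = κ → ∃ q, (p q).IsIso P := by
    intro P hP h1 h2
    refine ⟨equivShrink _ ⟦⟨P, hP, h1, h2⟩⟧, ?_⟩
    have : K.pairSetoid κ (c (equivShrink _ ⟦⟨P, hP, h1, h2⟩⟧)) ⟨P, hP, h1, h2⟩ := by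
      apply Quotient.exact
      simp [c]
    exact this
  have hQ : χ = Cardinal.lift.{u + 1} (κ + #(Shrink.{u} (Quotient (K.pairSetoid κ)))) := by
    have := lift_mk_eq'.2 ⟨(equivShrink.{u} (Quotient (K.pairSetoid κ))).symm⟩
    rw [hχ, lift_add, this, lift_id'.{u, u + 1}]
    rfl
  have hEC := mem_EC_iff_isPresentation p e hμ.aleph0_le
  have hexp : ∀ P : Pair L, P ∈ K.le → κ ≤ #P.small.carrier →
      ∃ P' : Pair (L.expand (skolemLanguage μ κ.out _)), IsPresentation p e P'.big ∧
        P'.reduct = P :=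
    hLS.exists_isPresentation hμ.aleph0_le hK hB hp'
  refine ⟨skolemLanguage μ κ.out _, presentationTheory p e hμ.aleph0_le, presentationTypes p e,
    ?_, ?_, ?_, ?_, ?_, ?_⟩
  · rw [card_expand_skolemLanguage hLS hμ hB, hQ]
  · rw [hQ]
    exact mk_presentationTheory_le p e hLS hμ.aleph0_le hB
  · rw [hQ]
    exact mk_presentationTypes p e hLS hμ hB
  · ext M
    constructor
    · rintro ⟨hM, hMκ⟩
      obtain ⟨P', hP', hM'⟩ := hexp ⟨M, Substr.whole M⟩ (hK.le_refl M hM)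
        (hMκ.trans_eq mk_univ.symm)
      exact ⟨P'.big, (hEC _).2 hP', congrArg Pair.big hM'⟩
    · rintro ⟨M', hM', rfl⟩
      have h := (hEC _).1 hM'
      exact ⟨(h.reduct_mem_and_hull_le hμ hK hp).1, hB.symm.trans_le (h.mk_le_mk_carrier hμ)⟩
  · exact fun P hP _ => ((hEC _).1 hP).reduct_le hμ hK hp P.small
  · intro P hP hPκ _
    obtain ⟨P', hP', hred⟩ := hexp P hP hPκ
    exact ⟨P', (hEC _).2 hP', (hEC _).2 (hP'.toStruc _), hred⟩
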